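/- Let $n\ge 0$ and let $\mathrm{Mat}(n)$ be the set of all matroids with ground set $[n]=\{1,\dots,n\}$. For $M\in\mathrm{Mat}(n)$ with rank function $\mathrm{rk}$ and $k=\mathrm{rk}([n])$, put $c(S)=\#S-\mathrm{rk}\,S$ for $S\subseteq[n]$, define integers $a(S)$ recursively by \[a(S)=c(S)-\sum_{T\subsetneq S}a(T)\] (so $a(\varnothing)=0$), and define the expected codimension of $M$ by \[\mathrm{ec}(M)=\sum_{S\subseteq[n]}(k-\mathrm{rk}\,S)\,a(S).\] Let $P(M)\subseteq\mathbb{R}^n$ be the matroid polytope of $M$, the convex hull of the indicator vectors of the bases of $M$. A matroidal subdivision of $P(M)$ is a polyhedral complex $\mathcal{D}$ with union $P(M)$ (a set of nonempty polytopes that contains every nonempty face of each of its members, and in which any two members meet in a common, possibly empty, face) all of whose members are matroid polytopes of matroids on $[n]$. Write $\mathcal{D}_{in}$ for the set of internal faces of $\mathcal{D}$, that is, the members of $\mathcal{D}$ that are not contained in the relative boundary of $P(M)$. Theorem. The expected codimension is a valuative matroid invariant: isomorphic matroids on $[n]$ have the same expected codimension, and for every $M\in\mathrm{Mat}(n)$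 and every matroidal subdivision $\mathcal{D}$ of $P(M)$, \[\mathrm{ec}(M)=\sum_{P(N)\in\mathcal{D}_{in}}(-1)^{\dim P(M)-\dim P(N)}\,\mathrm{ec}(N).\] -/

import Mathlib

namespace ExpCodim

/-- The set `Mat(n)` of all matroids with ground set `[n]` (indexed by `Fin n`). -/
def Mat (n : ℕ) : Type := {M : Matroid (Fin n) // M.E = Set.univ}

instance Mat.instFinite (n : ℕ) : Finite (Mat n) := by
  refine Finite.of_injective (fun M : Mat n => {B : Set (Fin n) | M.1.IsBase B}) ?_
  intro M N h
  refine Subtype.ext (Matroid.ext_isBase (M.2.trans N.2.symm) ?_)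
  intro B _
  exact Set.ext_iff.mp h B

noncomputable instance Mat.instFintype (n : ℕ) : Fintype (Mat n) := Fintype.ofFinite _

section Codimension

variable {n : ℕ}

/-- The rank `rk S` of a set in a matroid on `[n]`, as an integer. -/
noncomputable def rk (M : Mat n) (S : Finset (Fin n)) : ℤ :=
  ((M.1.eRk (S : Set (Fin n))).toNat : ℤ)

/-- `c(S) = #S - rk S`. -/
noncomputable def c (M : Mat n) (S : Finset (Fin n)) : ℤ := (S.card : ℤ) - rk M S

/-- `a_𝔖(S) = c(S) - ∑_{T ∈ 𝔖, T ⊊ S} a_𝔖(T)`; this gives `0` at the empty set, as `c(∅) = 0`. -/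
noncomputable def a (M : Mat n) (𝔖 : Finset (Finset (Fin n))) (S : Finset (Fin n)) : ℤ :=
  c M S - ∑ T ∈ (𝔖.filter (fun T => T ⊂ S)).attach, a M 𝔖 T.1
termination_by S.card
decreasing_by exact Finset.card_lt_card (Finset.mem_filter.mp T.2).2

/-- The expected codimension with respect to `𝔖`: the sum of `(k - rk S) a_𝔖(S)` over `S ∈ 𝔖`,
where `k = rk [n]` is the rank of the matroid. -/
noncomputable def ecWith (𝔖 : Finset (Finset (Fin n))) (M : Mat n) : ℤ :=
  ∑ S ∈ 𝔖, (rk M Finset.univ - rk M S) * a M 𝔖 S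

/-- The expected codimension `ec(M)`: take for `𝔖` all subsets of `[n]`. -/
noncomputable def ec (M : Mat n) : ℤ := ecWith Finset.univ M

end Codimension

section Polytopes

variable {n : ℕ}

/-- The matroid polytope `P(M)`: convex hull of the indicator vectors of the bases of `M`. -/
def polytope (M : Mat n) : Set (Fin n → ℝ) :=
  convexHull ℝ {v | ∃ B : Set (Fin n), M.1.IsBase B ∧ v = B.indicator (fun _ => (1 : ℝ))}

/-- The (affine) dimension of a nonempty subset of `ℝⁿ`. -/
noncomputable def dim (P : Set (Fin n → ℝ)) : ℕ := Module.finrank ℝ (vectorSpan ℝ P)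

/-- `D` is (the set of all nonempty faces of) a matroidal subdivision of `P(M)`: a polyhedral
complex with union `P(M)`, all of whose cells are matroid polytopes. Faces of a polytope are its
exposed subsets; the polytope itself is one of them, and so is the empty set. -/
structure IsMatroidalSubdivision (M : Mat n) (D : Set (Set (Fin n → ℝ))) : Prop where
  matroidal : ∀ F ∈ D, ∃ N : Mat n, F = polytope N
  face_mem : ∀ F ∈ D, ∀ G, IsExposed ℝ F G → G.Nonempty → G ∈ D
  inter_face : ∀ F ∈ D, ∀ G ∈ D, IsExposed ℝ F (F ∩ G) ∧ IsExposed ℝ G (F ∩ G)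
  sUnion_eq : ⋃₀ D = polytope M

/-- The internal faces of a subdivision `D` of `P(M)`: the cells that do not lie in the relative
boundary of `P(M)`. -/
def internalFaces (M : Mat n) (D : Set (Set (Fin n → ℝ))) : Set (Set (Fin n → ℝ)) :=
  {F | F ∈ D ∧ ¬ F ⊆ intrinsicFrontier ℝ (polytope M)}

/-- `f` is valuative: for every matroidal subdivision `D` of a polytope `P(M)`, the value `f(M)` is
the sum of `(-1)^(dim P(M) - dim P(N)) f(N)` over the internal faces `P(N)` of `D`. -/
def IsValuative {A : Type*} [AddCommGroup A] (f : Mat n → A) : Prop :=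
  ∀ (M : Mat n) (D : Set (Set (Fin n → ℝ))), IsMatroidalSubdivision M D →
    open scoped Classical in
    f M = ∑ N : Mat n with polytope N ∈ internalFaces M D,
      (((dim (polytope M) : ℤ) - (dim (polytope N) : ℤ)).negOnePow : ℤ) • f N

/-- `f` is a matroid invariant: isomorphic matroids on `[n]` have the same value. -/
def IsInvariant {A : Type*} (f : Mat n → A) : Prop :=
  ∀ (M N : Mat n) (σ : Equiv.Perm (Fin n)),
    (∀ B : Set (Fin n), M.1.IsBase B ↔ N.1.IsBase (σ '' B)) → f M = f N

end Polytopes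

end ExpCodim

/-! Unfolding the recursion for `a` along subsets writes `ec` as an integer combination of ranks `rk
S` and products `rk S * rk T` with `T ⊆ S`; sets that are not nested never meet in a product.
Counting the integers below each rank writes these as sums of indicators of the conditions `p < rk S
∧ q < rk T`, so it is enough that each such indicator is valuative.

Since `x(S) ≤ rk S` on `P(M)`, and one basis attains the ranks of both members of a chain, the
condition says exactly that the relative interior of `P(M)` meets the open region `x(S) > p`, `x(T)
> q`. The intersection is then relatively open and convex of dimension `dim P(M)`, so the indicator
is `(-1) ^ dim P(M)` times its Euler characteristic with compact support
(`openEuler_algRelint_inter_rankRegion`). The relative interior of `P(M)` is the disjoint union of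
those of the internal faces (`sum_indicator_algRelint`), and this Euler characteristic is additive
(`sum_openEuler_eq_zero`); the signs in the definition of valuativity are the signs of the
dimensions.

Invariance holds because ranks are determined by the bases. -/

open scoped Pointwise

namespace ExpCodim

/-! ### Algebraic relative interiors and relatively open convex sets -/

section RelativeInterior

variable {E : Type*} [AddCommGroup E] [Module ℝ E]

/-- The algebraic relative interior of `P`: the points `x` of `P` such that every segment in `P`
ending at `x` can be prolonged beyond `x` inside `P`. -/
def algRelint (P : Set E) : Set E :=
  {x | x ∈ P ∧ ∀ y ∈ P, ∃ ε : ℝ, 0 < ε ∧ x + ε • (x - y) ∈ P}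

/-- A convex set is relatively open if it equals its algebraic relative interior. -/
structure RelOpenConvex (U : Set E) : Prop where
  convex : Convex ℝ U
  prolong : ∀ x ∈ U, ∀ y ∈ U, ∃ ε : ℝ, 0 < ε ∧ x + ε • (x - y) ∈ U

lemma algRelint_subset (P : Set E) : algRelint P ⊆ P := fun _ h => h.1

lemma _root_.Convex.add_smul_sub_mem_of_le {P : Set E} (hP : Convex ℝ P) {x v : E} {ε δ : ℝ}
    (hx : x ∈ P) (hε : 0 < ε) (h : x + ε • v ∈ P) (hδ : 0 ≤ δ) (hδε : δ ≤ ε) :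
    x + δ • v ∈ P := by
  have := hP.add_smul_sub_mem hx h (t := δ / ε) ⟨by positivity, (div_le_one hε).2 hδε⟩
  rwa [add_sub_cancel_left, smul_smul, div_mul_cancel₀ _ hε.ne'] at this

/-- Prolong `[y, z]` beyond `z` to `z'`; the segment from `z'` to `w` then crosses the ray from `y`
through the given point, beyond that point. -/
lemma combo_mem_algRelint {P : Set E} (hP : Convex ℝ P) {z w : E} (hz : z ∈ algRelint P)
    (hw : w ∈ P) {t : ℝ} (ht : 0 ≤ t) (ht1 : t < 1) : z + t • (w - z) ∈ algRelint P := by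
  refine ⟨hP.add_smul_sub_mem hz.1 hw ⟨ht, ht1.le⟩, fun y hy => ?_⟩
  obtain ⟨δ, hδ, hz'⟩ := hz.2 y hy
  have h1 : (1 + δ) ≠ 0 := by positivity
  have hD : 0 < 1 + δ * t := by positivity
  refine ⟨(1 - t) * δ / (1 + δ * t), div_pos (mul_pos (by linarith) hδ) hD, ?_⟩
  have key := hP hz' hw (a := (1 - t) / (1 + δ * t)) (b := (1 + δ) * t / (1 + δ * t))
    (div_nonneg (by linarith) hD.le) (by positivity)
    (by rw [← add_div, div_eq_one_iff_eq hD.ne']; ring)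
  convert key using 1
  match_scalars <;> field_simp <;> ring

lemma relOpenConvex_algRelint {P : Set E} (hP : Convex ℝ P) : RelOpenConvex (algRelint P) := by
  refine ⟨fun x hx y hy a b ha hb hab => ?_, fun x hx y hy => ?_⟩
  · rcases hb.lt_or_eq with hb' | rfl
    · rcases ha.lt_or_eq with ha' | rfl
      · have := combo_mem_algRelint hP hx hy.1 (t := b) hb (by linarith)
        convert this using 1
        obtain rfl : a = 1 - b := by linarith
        module
      · obtain rfl : b = 1 := by linarith
        simpa using hy
    · obtain rfl : a = 1 := by linarith
      simpa using hx
  · obtain ⟨ε, hε, h⟩ := hx.2 y hy.1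
    refine ⟨ε / 2, by positivity, ?_⟩
    have := combo_mem_algRelint hP hx h (t := 1 / 2) (by norm_num) (by norm_num)
    convert this using 1
    module

/-- The value of a linear functional attained as a maximum at a point of the relative interior is
attained everywhere. -/
lemma eq_of_isMax_algRelint {P : Set E} {x : E} (hx : x ∈ algRelint P) (f : E →ₗ[ℝ] ℝ)
    (h : ∀ y ∈ P, f y ≤ f x) {y : E} (hy : y ∈ P) : f y = f x := by
  obtain ⟨ε, hε, hm⟩ := hx.2 y hy
  have := h _ hm
  simp only [map_add, map_smul, map_sub, smul_eq_mul] at this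
  have h2 := h y hy
  nlinarith

lemma vectorSpan_eq_of_absorbs {P U : Set E} (hU : U ⊆ P) (hne : U.Nonempty)
    (h : ∀ x ∈ U, ∀ y ∈ P, ∃ ε : ℝ, 0 < ε ∧ x + ε • (y - x) ∈ U) :
    vectorSpan ℝ U = vectorSpan ℝ P := by
  obtain ⟨x, hx⟩ := hne
  refine le_antisymm (vectorSpan_mono ℝ hU) ?_
  rw [vectorSpan_eq_span_vsub_set_right ℝ (hU hx), Submodule.span_le]
  rintro _ ⟨y, hy, rfl⟩
  obtain ⟨ε, hε, hm⟩ := h x hx y hy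
  have := vsub_mem_vectorSpan ℝ hm hx
  rw [vsub_eq_sub, add_sub_cancel_left] at this
  simpa [smul_smul, hε.ne'] using (vectorSpan ℝ U).smul_mem ε⁻¹ this

namespace RelOpenConvex

variable {U : Set E}

/-- The vectors `v` for which both `v` and `-v` are admissible directions at `x` form a subspace, by
convexity, and it contains every `y - x` with `y ∈ U`. -/
lemma exists_add_smul_mem (hU : RelOpenConvex U) {x v : E} (hx : x ∈ U)
    (hv : v ∈ vectorSpan ℝ U) : ∃ ε : ℝ, 0 < ε ∧ x + ε • v ∈ U := by
  rw [vectorSpan_eq_span_vsub_set_right ℝ hx] at hv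
  suffices h : (∃ ε : ℝ, 0 < ε ∧ x + ε • v ∈ U) ∧ (∃ ε : ℝ, 0 < ε ∧ x + ε • (-v) ∈ U) from h.1
  induction hv using Submodule.span_induction with
  | mem v hv =>
    obtain ⟨y, hy, rfl⟩ := hv
    refine ⟨⟨1, one_pos, by simpa using hy⟩, ?_⟩
    obtain ⟨ε, hε, h⟩ := hU.prolong x hx y hy
    exact ⟨ε, hε, by simpa using h⟩
  | zero => exact ⟨⟨1, one_pos, by simpa using hx⟩, ⟨1, one_pos, by simpa using hx⟩⟩
  | add u v _ _ hu hv =>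
    have key : ∀ u v : E, (∃ ε : ℝ, 0 < ε ∧ x + ε • u ∈ U) → (∃ ε : ℝ, 0 < ε ∧ x + ε • v ∈ U) →
        ∃ ε : ℝ, 0 < ε ∧ x + ε • (u + v) ∈ U := by
      rintro u v ⟨ε, hε, h⟩ ⟨δ, hδ, h'⟩
      have h1 := hU.convex.add_smul_sub_mem_of_le hx hε h (lt_min hε hδ).le (min_le_left _ _)
      have h2 := hU.convex.add_smul_sub_mem_of_le hx hδ h' (lt_min hε hδ).le (min_le_right _ _)
      refine ⟨min ε δ / 2, half_pos (lt_min hε hδ), ?_⟩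
      convert hU.convex h1 h2 (a := 1 / 2) (b := 1 / 2) (by norm_num) (by norm_num)
        (by norm_num) using 1
      module
    exact ⟨key _ _ hu.1 hv.1, by rw [neg_add]; exact key _ _ hu.2 hv.2⟩
  | smul r v _ hv =>
    have key : ∀ r : ℝ, ∀ v : E, 0 < r → (∃ ε : ℝ, 0 < ε ∧ x + ε • v ∈ U) →
        ∃ ε : ℝ, 0 < ε ∧ x + ε • (r • v) ∈ U := by
      rintro r v hr ⟨ε, hε, h⟩
      exact ⟨ε / r, by positivity, by rwa [smul_smul, div_mul_cancel₀ _ hr.ne']⟩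
    rcases lt_trichotomy r 0 with hr | rfl | hr
    · have h1 := key (-r) _ (by linarith) hv.1
      have h2 := key (-r) _ (by linarith) hv.2
      simp only [smul_neg, neg_smul, neg_neg] at h1 h2 ⊢
      exact ⟨h2, h1⟩
    · exact ⟨⟨1, one_pos, by simpa using hx⟩, ⟨1, one_pos, by simpa using hx⟩⟩
    · refine ⟨key r v hr hv.1, ?_⟩
      have := key r _ hr hv.2
      rwa [smul_neg] at this

lemma inter {W : Set E} (hU : RelOpenConvex U) (hW : RelOpenConvex W) :
    RelOpenConvex (U ∩ W) := by
  refine ⟨hU.convex.inter hW.convex, fun x hx y hy => ?_⟩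
  obtain ⟨ε, hε, h⟩ := hU.prolong x hx.1 y hy.1
  obtain ⟨δ, hδ, h'⟩ := hW.prolong x hx.2 y hy.2
  exact ⟨min ε δ, lt_min hε hδ,
    hU.convex.add_smul_sub_mem_of_le hx.1 hε h (lt_min hε hδ).le (min_le_left _ _),
    hW.convex.add_smul_sub_mem_of_le hx.2 hδ h' (lt_min hε hδ).le (min_le_right _ _)⟩

lemma setOf_eq (f : E →ₗ[ℝ] ℝ) (t : ℝ) : RelOpenConvex {x | f x = t} := by
  refine ⟨convex_hyperplane f.isLinear t, fun x hx y hy => ⟨1, one_pos, ?_⟩⟩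
  simp only [Set.mem_ofPred_eq, map_add, map_smul, map_sub, smul_eq_mul] at *
  simp [hx, hy]

lemma setOf_lt (f : E →ₗ[ℝ] ℝ) (t : ℝ) : RelOpenConvex {x | t < f x} := by
  refine ⟨convex_halfSpace_gt f.isLinear t, fun x hx y hy => ?_⟩
  simp only [Set.mem_ofPred_eq, map_add, map_smul, map_sub, smul_eq_mul] at *
  refine ⟨(f x - t) / (2 * (|f x - f y| + 1)), by have := sub_pos.2 hx; positivity, ?_⟩
  have h1 : 0 < |f x - f y| + 1 := by positivity
  have h2 := neg_abs_le (f x - f y)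
  have : -((f x - t) / 2) ≤ (f x - t) / (2 * (|f x - f y| + 1)) * (f x - f y) := by
    rw [div_mul_eq_mul_div, ← neg_div, div_le_div_iff₀ (by norm_num) (by positivity)]
    nlinarith
  linarith

lemma vectorSpan_inter_setOf_eq (hU : RelOpenConvex U) (f : E →ₗ[ℝ] ℝ) {t : ℝ}
    (hne : (U ∩ {x | f x = t}).Nonempty) :
    vectorSpan ℝ (U ∩ {x | f x = t}) = vectorSpan ℝ U ⊓ LinearMap.ker f := by
  obtain ⟨x, hx⟩ := hne
  apply le_antisymm
  · refine le_inf (vectorSpan_mono ℝ Set.inter_subset_left) ?_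
    rw [vectorSpan_eq_span_vsub_set_right ℝ hx, Submodule.span_le]
    rintro _ ⟨y, hy, rfl⟩
    simp [hy.2.trans hx.2.symm]
  · rintro v ⟨hv, hf⟩
    obtain ⟨ε, hε, h⟩ := hU.exists_add_smul_mem hx.1 hv
    have hm : x + ε • v ∈ U ∩ {x | f x = t} := by
      refine ⟨h, ?_⟩
      have h0 : f v = 0 := hf
      have h1 : f x = t := hx.2
      simp [h0, h1]
    have := vsub_mem_vectorSpan ℝ hm hx
    rw [vsub_eq_sub, add_sub_cancel_left] at this
    simpa [smul_smul, hε.ne'] using (vectorSpan ℝ _).smul_mem ε⁻¹ this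

/-- Rank-nullity for `f` on the direction of `U`. The drop by exactly one is what flips the sign of
the Euler characteristic of a slice. -/
lemma finrank_vectorSpan_inter_setOf_eq [FiniteDimensional ℝ E] (hU : RelOpenConvex U)
    (f : E →ₗ[ℝ] ℝ) {t : ℝ} (hne : (U ∩ {x | f x = t}).Nonempty)
    (hc : ∃ x ∈ U, ∃ y ∈ U, f x ≠ f y) :
    Module.finrank ℝ (vectorSpan ℝ (U ∩ {x | f x = t})) + 1 =
      Module.finrank ℝ (vectorSpan ℝ U) := by
  rw [hU.vectorSpan_inter_setOf_eq f hne]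
  set V := vectorSpan ℝ U
  obtain ⟨x, hx, y, hy, hxy⟩ := hc
  have hsurj : Function.Surjective (f.domRestrict V) := by
    apply LinearMap.surjective
    intro h
    have := LinearMap.congr_fun h ⟨x - y, vsub_mem_vectorSpan ℝ hx hy⟩
    simp [sub_eq_zero, hxy] at this
  have h1 := LinearMap.finrank_range_add_finrank_ker (f.domRestrict V)
  rw [LinearMap.range_eq_top.2 hsurj, finrank_top, Module.finrank_self] at h1
  have h2 : Module.finrank ℝ (LinearMap.ker (f.domRestrict V)) =
      Module.finrank ℝ (V ⊓ LinearMap.ker f : Submodule ℝ E) := by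
    rw [LinearMap.ker_domRestrict, ← Submodule.finrank_map_subtype_eq V,
      Submodule.map_comap_subtype]
  omega

end RelOpenConvex

/-- Intersecting the relative interior of `P` with a set that is open along segments does not
change the direction. -/
lemma vectorSpan_algRelint_inter {P K : Set E} (hP : Convex ℝ P)
    (hK : ∀ x ∈ K, ∀ v : E, ∃ ε : ℝ, 0 < ε ∧ ε < 1 ∧ x + ε • v ∈ K)
    (hne : (algRelint P ∩ K).Nonempty) :
    vectorSpan ℝ (algRelint P ∩ K) = vectorSpan ℝ P := by
  refine vectorSpan_eq_of_absorbs (Set.inter_subset_left.trans (algRelint_subset P)) hne ?_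
  intro x hx y hy
  obtain ⟨ε, hε, hε1, h⟩ := hK x hx.2 (y - x)
  exact ⟨ε, hε, combo_mem_algRelint hP hx.1 hy hε.le hε1, h⟩

end RelativeInterior

/-! ### Comparison with the topological relative interior; supporting hyperplanes -/

section Normed

variable {E : Type*} [NormedAddCommGroup E] [NormedSpace ℝ E]

lemma exists_prolong_mem_interior {s : Set E} {x : E} (hx : x ∈ interior s) (v : E) :
    ∃ ε : ℝ, 0 < ε ∧ ε < 1 ∧ x + ε • v ∈ s := by
  have hc : Filter.Tendsto (fun ε : ℝ => x + ε • v) (nhdsWithin 0 (Set.Ioi 0)) (nhds x) := by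
    have : Continuous (fun ε : ℝ => x + ε • v) := by fun_prop
    simpa using (this.tendsto 0).mono_left nhdsWithin_le_nhds
  have h1 := hc.eventually (mem_interior_iff_mem_nhds.1 hx)
  have h2 : ∀ᶠ ε : ℝ in nhdsWithin 0 (Set.Ioi 0), ε ∈ Set.Ioo (0 : ℝ) 1 :=
    Ioo_mem_nhdsGT one_pos
  obtain ⟨ε, h, h'⟩ := (h1.and h2).exists
  exact ⟨ε, h'.1, h'.2, h⟩

lemma intrinsicInterior_subset_algRelint {P : Set E} :
    intrinsicInterior ℝ P ⊆ algRelint P := by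
  rintro _ ⟨x, hx, rfl⟩
  have hxP : (x : E) ∈ P := by simpa using interior_subset hx
  refine ⟨hxP, fun y hy => ?_⟩
  have : Nonempty (affineSpan ℝ P) := ⟨x⟩
  have hy' : y ∈ affineSpan ℝ P := subset_affineSpan ℝ P hy
  have hc : Continuous (fun ε : ℝ => AffineMap.lineMap x (⟨y, hy'⟩ : affineSpan ℝ P) ε) := by
    fun_prop
  have h1 := (hc.tendsto 0)
  rw [AffineMap.lineMap_apply_zero] at h1
  have h2 := (h1.eventually (mem_interior_iff_mem_nhds.1 hx))
  have h3 : Filter.Tendsto (fun ε : ℝ => -ε) (nhdsWithin 0 (Set.Ioi 0)) (nhds 0) := by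
    have : Continuous (fun ε : ℝ => -ε) := by fun_prop
    simpa using (this.tendsto 0).mono_left nhdsWithin_le_nhds
  have h4 := (h3.eventually h2).and self_mem_nhdsWithin
  obtain ⟨ε, h, hε⟩ := h4.exists
  refine ⟨ε, hε, ?_⟩
  convert h using 1
  simp [AffineMap.lineMap_apply]
  module

variable [FiniteDimensional ℝ E]

/-- A point of a convex set outside its relative interior lies in a proper exposed face. -/
lemma exists_support_of_notMem_algRelint {P : Set E} (hP : Convex ℝ P) {x : E} (hx : x ∈ P)
    (hxr : x ∉ algRelint P) :
    ∃ f : StrongDual ℝ E, (∀ y ∈ P, f y ≤ f x) ∧ ∃ y ∈ P, f y < f x := by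
  -- Thickening `P` by a complement of its direction gives a convex set with nonempty interior, to
  -- which Hahn–Banach applies.
  obtain ⟨W, hW⟩ := Submodule.exists_isCompl (vectorSpan ℝ P)
  set s : Set E := P + (W : Set E) with hs
  have hPs : P ⊆ s := fun y hy => ⟨y, hy, 0, W.zero_mem, by simp⟩
  have hsc : Convex ℝ s := hP.add W.convex
  have hspan : affineSpan ℝ s = ⊤ := by
    rw [ AffineSubspace.affineSpan_eq_top_iff_vectorSpan_eq_top_of_nonempty ℝ E E ⟨x, hPs hx⟩,
      eq_top_iff, ← hW.sup_eq_top]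
    refine sup_le (vectorSpan_mono ℝ hPs) fun w hw => ?_
    have : x + w ∈ s := ⟨x, hx, w, hw, rfl⟩
    simpa using vsub_mem_vectorSpan ℝ this (hPs hx)
  have hint : (interior s).Nonempty := hsc.interior_nonempty_iff_affineSpan_eq_top.2 hspan
  have hxi : x ∉ interior s := by
    intro hxi
    refine hxr ⟨hx, fun y hy => ?_⟩
    obtain ⟨ε, hε, -, p, hp, w, hw, hpw⟩ := exists_prolong_mem_interior hxi (x - y)
    refine ⟨ε, hε, ?_⟩
    have hwV : w ∈ vectorSpan ℝ P := by
      have : w = (x - p) + ε • (x - y) := by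
        have hpw' : p + w = x + ε • (x - y) := hpw
        rw [← add_right_inj p, hpw']; abel
      rw [this]
      exact add_mem (vsub_mem_vectorSpan ℝ hx hp)
        (Submodule.smul_mem _ _ (vsub_mem_vectorSpan ℝ hx hy))
    have hw0 : w = 0 := (Submodule.disjoint_def.1 hW.disjoint) w hwV hw
    have hpw' : p + w = x + ε • (x - y) := hpw
    rw [← hpw', hw0, add_zero]
    exact hp
  obtain ⟨f, hf⟩ := geometric_hahn_banach_open_point hsc.interior isOpen_interior hxi
  have hle : ∀ y ∈ s, f y ≤ f x := by
    intro y hy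
    have : y ∈ closure (interior s) := by
      rw [hsc.closure_interior_eq_closure_of_nonempty_interior hint]
      exact subset_closure hy
    exact closure_minimal (fun a ha => (hf a ha).le)
      (isClosed_le f.continuous continuous_const) this
  refine ⟨f, fun y hy => hle y (hPs hy), ?_⟩
  -- If `f` were constant on `P`, an interior point `p + w` would force `f w < 0`, while `x - w` in
  -- the thickened set forces `f w ≥ 0`.
  by_contra! hcon
  obtain ⟨z, hz⟩ := hint
  obtain ⟨p, hp, w, hw, rfl⟩ := interior_subset hz
  have h1 := hf _ hz
  have h2 := hcon p hp
  have h3 := hle (x + -w) ⟨x, hx, -w, W.neg_mem hw, rfl⟩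
  simp only [map_add, map_neg] at h1 h3
  linarith

/-- Prolong the segment from an intrinsic interior point `z` to `x` up to `w ∈ P`. The homothety
centred at `w` taking `z` to `x` is open and carries a neighbourhood of `z` in the affine span into
`P`. -/
lemma algRelint_subset_intrinsicInterior {P : Set E} (hP : Convex ℝ P) :
    algRelint P ⊆ intrinsicInterior ℝ P := by
  intro x hx
  have hne : P.Nonempty := ⟨x, hx.1⟩
  obtain ⟨_, z, hz, rfl⟩ := hne.intrinsicInterior hP
  obtain ⟨ε, hε, hw⟩ := hx.2 z (by simpa using interior_subset hz)
  have : Nonempty (affineSpan ℝ P) := ⟨z⟩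
  set w : affineSpan ℝ P := ⟨_, subset_affineSpan ℝ P hw⟩ with hwdef
  set t : ℝ := ε / (1 + ε) with ht
  have ht0 : 0 < t := by positivity
  have ht1 : t ≤ 1 := (div_le_one (by positivity)).2 (by linarith)
  have hopen := AffineMap.homothety_isOpenMap w t ht0.ne'
  have hsub : AffineMap.homothety w t '' interior ((↑) ⁻¹' P : Set (affineSpan ℝ P)) ⊆
      ((↑) ⁻¹' P : Set (affineSpan ℝ P)) := by
    rintro _ ⟨y, hy, rfl⟩
    have hyP : (y : E) ∈ P := by simpa using interior_subset hy
    have := hP.add_smul_sub_mem hw hyP (t := t) ⟨ht0.le, ht1⟩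
    simp only [Set.mem_preimage, AffineMap.homothety_apply]
    convert this using 1
    simp [hwdef, add_comm]
  refine ⟨AffineMap.homothety w t z, interior_maximal hsub (hopen _ isOpen_interior)
    ⟨z, hz, rfl⟩, ?_⟩
  have h1 : (1 + ε) ≠ 0 := by positivity
  simp only [AffineMap.homothety_apply, hwdef, ht]
  simp
  match_scalars <;> field_simp <;> ring

lemma intrinsicFrontier_eq_sdiff_algRelint {P : Set E} (hP : Convex ℝ P) (hc : IsClosed P) :
    intrinsicFrontier ℝ P = P \ algRelint P := by
  rw [(intrinsicInterior_subset_algRelint (P := P)).antisymm'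
    (algRelint_subset_intrinsicInterior hP), ← intrinsicClosure_sdiff_intrinsicInterior,
    intrinsicClosure_eq_closure, hc.closure_eq]

lemma algRelint_nonempty {P : Set E} (hP : Convex ℝ P) (hne : P.Nonempty) :
    (algRelint P).Nonempty :=
  (hne.intrinsicInterior hP).mono intrinsicInterior_subset_algRelint

end Normed

/-! ### Additivity of the Euler characteristic with compact support -/

section EulerCharacteristic

variable {n : ℕ}

open scoped Classical in
/-- The Euler characteristic with compact support of a relatively open convex set: `(-1) ^ dim U`
if `U` is nonempty, and `0` otherwise. -/
noncomputable def openEuler (U : Set (Fin n → ℝ)) : ℤ :=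
  if U.Nonempty then (-1) ^ dim U else 0

lemma openEuler_of_nonempty {U : Set (Fin n → ℝ)} (h : U.Nonempty) :
    openEuler U = (-1) ^ dim U := if_pos h

lemma openEuler_of_not_nonempty {U : Set (Fin n → ℝ)} (h : ¬ U.Nonempty) :
    openEuler U = 0 := if_neg h

/-- The Euler characteristic of a slice of `U`, minus that of a slightly later slice, is nonzero
only at the first slice. -/
lemma eventually_openEuler_slice {U : Set (Fin n → ℝ)} (hU : RelOpenConvex U)
    (hne : U.Nonempty) (f : (Fin n → ℝ) →ₗ[ℝ] ℝ) (hb : BddBelow (f '' U)) (t : ℝ) :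
    ∀ᶠ t' in nhdsWithin t (Set.Ioi t),
      openEuler (U ∩ {x | f x = t}) - openEuler (U ∩ {x | f x = t'}) =
        if sInf (f '' U) = t then openEuler U else 0 := by
  have hlt : ∀ᶠ t' in nhdsWithin t (Set.Ioi t), t < t' := self_mem_nhdsWithin
  have hbelow : ∀ b, t < b → ∀ᶠ t' in nhdsWithin t (Set.Ioi t), t' < b := fun b hb =>
    (eventually_lt_nhds hb).filter_mono nhdsWithin_le_nhds
  have hInf : ∀ x ∈ U, sInf (f '' U) ≤ f x := fun x hx => csInf_le hb ⟨x, hx, rfl⟩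
  have hempty : ∀ u, (∀ x ∈ U, f x ≠ u) → openEuler (U ∩ {x | f x = u}) = 0 := fun u hu =>
    openEuler_of_not_nonempty fun ⟨x, hx, hxu⟩ => hu x hx hxu
  -- If `f` is not constant, it has no extremum on `U` and nonempty slices have Euler characteristic
  -- `-openEuler U`: the jump occurs at the unattained infimum, from `0` to `-openEuler U`. If `f`
  -- is constant, `U` is its only nonempty slice.
  by_cases hc : ∃ x ∈ U, ∃ y ∈ U, f x ≠ f y
  · have hslice : ∀ u, (∃ x ∈ U, f x = u) → openEuler (U ∩ {x | f x = u}) = - openEuler U := by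
      rintro u ⟨x, hx, hxu⟩
      have hn : (U ∩ {x | f x = u}).Nonempty := ⟨x, hx, hxu⟩
      rw [openEuler_of_nonempty hn, openEuler_of_nonempty hne]
      have : dim U = dim (U ∩ {x | f x = u}) + 1 :=
        (hU.finrank_vectorSpan_inter_setOf_eq f hn hc).symm
      rw [this, pow_succ]; ring
    have hmid : ∀ x ∈ U, ∀ y ∈ U, ∀ u, f x ≤ u → u ≤ f y → ∃ z ∈ U, f z = u := by
      intro x hx y hy u hxu huy
      have : (f '' U).OrdConnected := (hU.convex.linear_image f).ordConnected
      exact this.out ⟨x, hx, rfl⟩ ⟨y, hy, rfl⟩ ⟨hxu, huy⟩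
    have hbig : ∀ x ∈ U, (∃ y ∈ U, f x < f y) ∧ (∃ y ∈ U, f y < f x) := by
      intro x hx
      obtain ⟨y, hy, hxy⟩ : ∃ y ∈ U, f y ≠ f x := by
        by_contra! h
        obtain ⟨a, ha, b, hb', hab⟩ := hc
        exact hab ((h a ha).trans (h b hb').symm)
      obtain ⟨ε, hε, hm⟩ := hU.prolong x hx y hy
      have hfm : f (x + ε • (x - y)) = f x + ε * (f x - f y) := by simp
      rcases lt_or_gt_of_ne hxy with h | h
      · exact ⟨⟨_, hm, by rw [hfm]; nlinarith⟩, ⟨y, hy, h⟩⟩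
      · exact ⟨⟨y, hy, h⟩, ⟨_, hm, by rw [hfm]; nlinarith⟩⟩
    by_cases ht : ∃ x ∈ U, f x = t
    · obtain ⟨x, hx, rfl⟩ := ht
      obtain ⟨⟨y, hy, hxy⟩, ⟨z, hz, hzx⟩⟩ := hbig x hx
      rw [if_neg ((hInf z hz).trans_lt hzx).ne]
      filter_upwards [hlt, hbelow _ hxy] with t' h1 h2
      rw [hslice _ ⟨x, hx, rfl⟩, hslice t' (hmid x hx y hy t' h1.le h2.le), sub_self]
    · rw [hempty t (by push Not at ht; exact ht)]
      rcases lt_trichotomy (sInf (f '' U)) t with h | h | h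
      · rw [if_neg h.ne]
        obtain ⟨_, ⟨x, hx, rfl⟩, hxt⟩ := exists_lt_of_csInf_lt (hne.image f) h
        filter_upwards [hlt] with t' h1
        rw [hempty t', sub_zero]
        rintro y hy rfl
        exact ht (hmid x hx y hy t hxt.le h1.le)
      · rw [if_pos h]
        obtain ⟨y, hy⟩ := hne
        have hty : t < f y := lt_of_le_of_ne (h ▸ hInf y hy) fun e => ht ⟨y, hy, e.symm⟩
        filter_upwards [hlt, hbelow _ hty] with t' h1 h2
        obtain ⟨_, ⟨x, hx, rfl⟩, hxt⟩ := exists_lt_of_csInf_lt (Set.Nonempty.image f ⟨y, hy⟩)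
          (h.trans_lt h1)
        rw [hslice t' (hmid x hx y hy t' hxt.le h2.le)]
        ring
      · rw [if_neg h.ne']
        filter_upwards [hbelow _ h] with t' h1
        rw [hempty t', sub_zero]
        rintro y hy rfl
        exact absurd (hInf y hy) (not_le.2 h1)
  · push Not at hc
    obtain ⟨x, hx⟩ := hne
    have himg : f '' U = {f x} := by
      ext u
      exact ⟨fun ⟨y, hy, h⟩ => h ▸ hc y hy x hx, fun h => ⟨x, hx, h.symm⟩⟩
    rw [himg, csInf_singleton]
    by_cases ht : f x = t
    · rw [if_pos ht]
      filter_upwards [hlt] with t' h1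
      rw [hempty t' fun y hy h => h1.ne (by rw [← ht, ← h, hc y hy x hx]), sub_zero]
      congr 1
      exact Set.inter_eq_left.2 fun y hy => (hc y hy x hx).trans ht
    · rw [if_neg ht]
      rw [hempty t fun y hy h => ht (by rw [← h, hc y hy x hx])]
      rcases lt_or_gt_of_ne ht with h | h
      · filter_upwards [hlt] with t' h1
        rw [hempty t' fun y hy h' => (h.trans h1).ne (by rw [← h', hc y hy x hx]), sub_zero]
      · filter_upwards [hbelow _ h] with t' h1
        rw [hempty t' fun y hy h' => h1.ne (by rw [← h', hc y hy x hx]), sub_zero]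

/-- The Euler characteristic of relatively open convex sets depends on indicator functions only,
for sets in a common coordinate subspace. -/
lemma sum_openEuler_eq_zero_aux {ι : Type*} (s : Finset ι) (c : ι → ℤ) (m : ℕ) :
    ∀ U : ι → Set (Fin n → ℝ), (∀ i ∈ s, RelOpenConvex (U i)) → (∀ i ∈ s, BddBelow (U i)) →
      (∃ z : Fin n → ℝ, ∀ i ∈ s, ∀ x ∈ U i, ∀ j : Fin n, m ≤ j → x j = z j) →
      (∀ x, ∑ i ∈ s, c i * (U i).indicator 1 x = 0) →
      ∑ i ∈ s, c i * openEuler (U i) = 0 := by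
  induction m with
  | zero =>
    rintro U hU - ⟨z, hz⟩ h
    rw [← h z]
    refine Finset.sum_congr rfl fun i hi => ?_
    have hsub : U i ⊆ {z} := fun x hx => funext fun j => hz i hi x hx j (Nat.zero_le _)
    rcases Set.subset_singleton_iff_eq.1 hsub with h | h
    · rw [h, openEuler_of_not_nonempty Set.not_nonempty_empty]; simp
    · rw [h, openEuler_of_nonempty (Set.singleton_nonempty z), dim, vectorSpan_singleton,
        finrank_bot]
      simp
  | succ m ih =>
    rintro U hU hb ⟨z, hz⟩ h
    by_cases hm : m < n
    swap
    · exact ih U hU hb ⟨z, fun i hi x hx j hj => absurd j.2 (by omega)⟩ h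
    let f : (Fin n → ℝ) →ₗ[ℝ] ℝ := LinearMap.proj ⟨m, hm⟩
    have hslice : ∀ t : ℝ, ∑ i ∈ s, c i * openEuler (U i ∩ {x | f x = t}) = 0 := by
      intro t
      refine ih _ (fun i hi => (hU i hi).inter (.setOf_eq f t))
        (fun i hi => (hb i hi).mono Set.inter_subset_left)
        ⟨Function.update z ⟨m, hm⟩ t, fun i hi x hx j hj => ?_⟩ fun x => ?_
      · rcases eq_or_ne j ⟨m, hm⟩ with rfl | hne
        · rw [Function.update_self]; exact hx.2
        · rw [Function.update_of_ne hne]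
          refine hz i hi x hx.1 j ?_
          have : (j : ℕ) ≠ m := fun e => hne (Fin.ext e)
          omega
      · by_cases hx : f x = t
        · rw [← h x]
          refine Finset.sum_congr rfl fun i _ => ?_
          by_cases hxi : x ∈ U i <;> simp [hxi, hx]
        · exact Finset.sum_eq_zero fun i _ => by simp [hx]
    have hfirst : ∀ t : ℝ,
        ∑ i ∈ s, (if sInf (f '' U i) = t then c i * openEuler (U i) else 0) = 0 := by
      intro t
      have hev : ∀ i ∈ s, ∀ᶠ t' in nhdsWithin t (Set.Ioi t),
          c i * openEuler (U i ∩ {x | f x = t}) - c i * openEuler (U i ∩ {x | f x = t'}) =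
            if sInf (f '' U i) = t then c i * openEuler (U i) else 0 := by
        intro i hi
        by_cases hne : (U i).Nonempty
        · have hbf : BddBelow (f '' U i) := by
            obtain ⟨b, hb'⟩ := hb i hi
            exact ⟨b ⟨m, hm⟩, by rintro _ ⟨x, hx, rfl⟩; exact hb' hx _⟩
          filter_upwards [eventually_openEuler_slice (hU i hi) hne f hbf t] with t' ht'
          rw [← mul_sub, ht', mul_ite, mul_zero]
        · rw [Set.not_nonempty_iff_eq_empty] at hne
          simp [hne, openEuler]
      -- One `t'` serves all the finitely many indices, so the jumps at `t` add up to a difference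
      -- of two vanishing slice sums.
      obtain ⟨t', ht'⟩ := ((Filter.eventually_all_finset s).2 hev).exists
      rw [← Finset.sum_congr rfl ht', Finset.sum_sub_distrib, hslice, hslice, sub_zero]
    classical
    -- Each `U i` contributes at a single value of `t`, its infimum; summing `hfirst` over these
    -- values recovers the whole sum.
    rw [← Finset.sum_fiberwise_of_maps_to
      (fun i hi => Finset.mem_image_of_mem (fun i => sInf (f '' U i)) hi)]
    refine Finset.sum_eq_zero fun t _ => ?_
    rw [Finset.sum_filter]
    exact hfirst t

/-- The Euler characteristic of bounded below relatively open convex sets depends on indicator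
functions only. -/
theorem sum_openEuler_eq_zero {ι : Type*} (s : Finset ι) (c : ι → ℤ) (U : ι → Set (Fin n → ℝ))
    (hU : ∀ i ∈ s, RelOpenConvex (U i)) (hb : ∀ i ∈ s, BddBelow (U i))
    (h : ∀ x, ∑ i ∈ s, c i * (U i).indicator 1 x = 0) :
    ∑ i ∈ s, c i * openEuler (U i) = 0 :=
  sum_openEuler_eq_zero_aux s c n U hU hb
    ⟨0, fun _ _ _ _ j hj => absurd j.2 (not_lt.2 hj)⟩ h

end EulerCharacteristic

/-! ### Matroid polytopes and rank conditions -/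

section MatroidPolytopes

variable {n : ℕ}

/-- The linear functional `x ↦ ∑ i ∈ S, x i`. -/
def sumOn (S : Finset (Fin n)) : (Fin n → ℝ) →ₗ[ℝ] ℝ := ∑ i ∈ S, LinearMap.proj i

lemma sumOn_apply (S : Finset (Fin n)) (x : Fin n → ℝ) : sumOn S x = ∑ i ∈ S, x i := by
  simp [sumOn]

lemma sumOn_indicator (S : Finset (Fin n)) (B : Set (Fin n)) :
    sumOn S (B.indicator fun _ => (1 : ℝ)) = (B ∩ S).ncard := by
  classical
  rw [sumOn_apply, Set.ncard_eq_toFinset_card', ← Finset.sum_filter_add_sum_filter_not S (· ∈ B),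
    Finset.sum_congr rfl (g := fun _ => (1 : ℝ)), Finset.sum_eq_zero (s := S.filter (· ∉ B))]
  · rw [add_zero, Finset.sum_const, nsmul_eq_mul, mul_one]
    congr 2
    ext i
    simp [and_comm]
  · intro i hi; simp [(Finset.mem_filter.1 hi).2]
  · intro i hi; simp [(Finset.mem_filter.1 hi).2]

lemma ncard_inter_le_rk (M : Mat n) {B : Set (Fin n)} (hB : M.1.IsBase B)
    (S : Finset (Fin n)) : ((B ∩ S).ncard : ℤ) ≤ rk M S := by
  have h := (hB.indep.subset Set.inter_subset_left).encard_le_eRk_of_subset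
    (Set.inter_subset_right : B ∩ S ⊆ S)
  have htop : M.1.eRk (S : Set (Fin n)) ≠ ⊤ :=
    ((M.1.eRk_le_encard _).trans_lt (Set.toFinite _).encard_lt_top).ne
  rw [rk, Nat.cast_le, Set.ncard]
  exact ENat.toNat_le_toNat h htop

/-- Two members of a chain of sets have their ranks attained by a common basis. -/
lemma exists_isBase_ncard_inter_eq_rk (M : Mat n) {T S : Finset (Fin n)} (hTS : T ⊆ S) :
    ∃ B, M.1.IsBase B ∧ rk M S = (B ∩ S).ncard ∧ rk M T = (B ∩ T).ncard := by
  have hE : ∀ X : Set (Fin n), X ⊆ M.1.E := fun X => by rw [M.2]; exact Set.subset_univ X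
  obtain ⟨I, hI⟩ := M.1.exists_isBasis (T : Set (Fin n)) (hE _)
  obtain ⟨J, hJ, hIJ⟩ := hI.indep.subset_isBasis_of_subset
    (hI.subset.trans (Finset.coe_subset.2 hTS)) (hE _)
  obtain ⟨B, hB, hJB⟩ := hJ.indep.exists_isBase_superset
  refine ⟨B, hB, ?_, ?_⟩
  · rw [rk, hJ.inter_eq_of_subset_indep hJB hB.indep, ← hJ.encard_eq_eRk, Set.ncard]
  · rw [rk, hI.inter_eq_of_subset_indep (hIJ.trans hJB) hB.indep, ← hI.encard_eq_eRk, Set.ncard]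

lemma indicator_mem_polytope (M : Mat n) {B : Set (Fin n)} (hB : M.1.IsBase B) :
    B.indicator (fun _ => (1 : ℝ)) ∈ polytope M :=
  subset_convexHull ℝ _ ⟨B, hB, rfl⟩

lemma convex_polytope (M : Mat n) : Convex ℝ (polytope M) := convex_convexHull ℝ _

lemma polytope_nonempty (M : Mat n) : (polytope M).Nonempty :=
  let ⟨_, hB⟩ := M.1.exists_isBase
  ⟨_, indicator_mem_polytope M hB⟩

lemma isClosed_polytope (M : Mat n) : IsClosed (polytope M) := by
  refine Set.Finite.isClosed_convexHull _ (Set.Finite.subset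
    (Set.finite_range fun B : Set (Fin n) => B.indicator fun _ => (1 : ℝ)) ?_)
  rintro _ ⟨B, -, rfl⟩
  exact ⟨B, rfl⟩

/-- A linear upper bound valid at all bases is valid on the polytope. -/
lemma le_of_mem_polytope (M : Mat n) (f : (Fin n → ℝ) →ₗ[ℝ] ℝ) {r : ℝ}
    (h : ∀ B, M.1.IsBase B → f (B.indicator fun _ => 1) ≤ r) {x : Fin n → ℝ}
    (hx : x ∈ polytope M) : f x ≤ r := by
  refine convexHull_min (t := {x | f x ≤ r}) ?_ (convex_halfSpace_le f.isLinear r) hx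
  rintro _ ⟨B, hB, rfl⟩
  exact h B hB

lemma sumOn_le_rk (M : Mat n) (S : Finset (Fin n)) {x : Fin n → ℝ} (hx : x ∈ polytope M) :
    sumOn S x ≤ rk M S := by
  refine le_of_mem_polytope M _ (fun B hB => ?_) hx
  rw [sumOn_indicator]
  exact_mod_cast ncard_inter_le_rk M hB S

lemma bddBelow_polytope (M : Mat n) : BddBelow (polytope M) := by
  refine ⟨0, fun x hx i => ?_⟩
  have := le_of_mem_polytope M (-LinearMap.proj i) (r := 0) (fun B _ => ?_) hx
  · simpa using this
  · simpa using Set.indicator_nonneg (fun _ _ => zero_le_one) i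

lemma isBase_of_indicator_mem_polytope (M : Mat n) {B : Set (Fin n)}
    (h : B.indicator (fun _ => (1 : ℝ)) ∈ polytope M) : M.1.IsBase B := by
  classical
  by_contra hB
  -- Among 0/1 vectors, `x(B) - x(Bᶜ)` takes its maximum `#B` only at the indicator of `B`.
  have hle := le_of_mem_polytope M (sumOn B.toFinset - sumOn B.toFinsetᶜ)
    (r := (B.ncard : ℝ) - 1) (fun B' hB' => ?_) h
  · rw [LinearMap.sub_apply, sumOn_indicator, sumOn_indicator] at hle
    simp at hle
    linarith
  · rw [LinearMap.sub_apply, sumOn_indicator, sumOn_indicator]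
    simp only [Set.coe_toFinset, Finset.coe_compl]
    have hne : B' ≠ B := fun e => hB (e ▸ hB')
    have key : (B' ∩ B).ncard + 1 ≤ B.ncard + (B' ∩ Bᶜ).ncard := by
      by_cases hs : B ⊆ B'
      · have : (B' ∩ Bᶜ).Nonempty := by
          by_contra h0
          refine hne (Set.Subset.antisymm (fun x hx => ?_) hs)
          by_contra hxB
          exact h0 ⟨x, hx, hxB⟩
        rw [Set.inter_eq_right.2 hs]
        have := (Set.ncard_pos (Set.toFinite _)).2 this
        omega
      · have : (B' ∩ B).ncard < B.ncard := Set.ncard_lt_ncard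
          ⟨Set.inter_subset_right, fun h' => hs (h'.trans Set.inter_subset_left)⟩ (Set.toFinite _)
        omega
    have : ((B' ∩ B).ncard : ℝ) + 1 ≤ B.ncard + (B' ∩ Bᶜ).ncard := by exact_mod_cast key
    linarith

lemma polytope_injective : Function.Injective (polytope : Mat n → Set (Fin n → ℝ)) := by
  intro M N h
  refine Subtype.ext (Matroid.ext_isBase (M.2.trans N.2.symm) fun B _ => ⟨fun hB => ?_, fun hB => ?_⟩)
  · exact isBase_of_indicator_mem_polytope N (h ▸ indicator_mem_polytope M hB)
  · exact isBase_of_indicator_mem_polytope M (h ▸ indicator_mem_polytope N hB)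

/-- The open polyhedron of points `x` with `x(S) > p` and `x(T) > q`. -/
def rankRegion (S T : Finset (Fin n)) (p q : ℤ) : Set (Fin n → ℝ) :=
  {x | (p : ℝ) < sumOn S x} ∩ {x | (q : ℝ) < sumOn T x}

lemma relOpenConvex_rankRegion (S T : Finset (Fin n)) (p q : ℤ) :
    RelOpenConvex (rankRegion S T p q) :=
  (RelOpenConvex.setOf_lt _ _).inter (.setOf_lt _ _)

lemma isOpen_rankRegion (S T : Finset (Fin n)) (p q : ℤ) : IsOpen (rankRegion S T p q) :=
  (isOpen_lt continuous_const (sumOn S).continuous_of_finiteDimensional).inter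
    (isOpen_lt continuous_const (sumOn T).continuous_of_finiteDimensional)

/-- For the converse, the vertex of a basis attaining both ranks lies in the open region, and stays
there when moved slightly towards a relative interior point. -/
lemma algRelint_inter_rankRegion_nonempty_iff (M : Mat n) {S T : Finset (Fin n)} (hTS : T ⊆ S)
    (p q : ℤ) :
    (algRelint (polytope M) ∩ rankRegion S T p q).Nonempty ↔ p < rk M S ∧ q < rk M T := by
  constructor
  · rintro ⟨x, hx, hp, hq⟩
    have hp' : (p : ℝ) < sumOn S x := hp
    have hq' : (q : ℝ) < sumOn T x := hq
    exact ⟨by exact_mod_cast hp'.trans_le (sumOn_le_rk M S hx.1),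
      by exact_mod_cast hq'.trans_le (sumOn_le_rk M T hx.1)⟩
  · rintro ⟨hp, hq⟩
    obtain ⟨B, hB, hS, hT⟩ := exists_isBase_ncard_inter_eq_rk M hTS
    have hv : B.indicator (fun _ => (1 : ℝ)) ∈ rankRegion S T p q := by
      refine ⟨?_, ?_⟩
      · rw [Set.mem_ofPred_eq, sumOn_indicator]; rw [hS] at hp; exact_mod_cast hp
      · rw [Set.mem_ofPred_eq, sumOn_indicator]; rw [hT] at hq; exact_mod_cast hq
    obtain ⟨z, hz⟩ := algRelint_nonempty (convex_polytope M) (polytope_nonempty M)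
    obtain ⟨ε, hε, hε1, hm⟩ := exists_prolong_mem_interior
      ((isOpen_rankRegion S T p q).interior_eq.symm ▸ hv) (z - B.indicator fun _ => (1 : ℝ))
    refine ⟨_, ?_, hm⟩
    have := combo_mem_algRelint (convex_polytope M) hz (indicator_mem_polytope M hB)
      (t := 1 - ε) (by linarith) (by linarith)
    convert this using 1
    module

open scoped Classical in
lemma openEuler_algRelint_inter_rankRegion (M : Mat n) {S T : Finset (Fin n)} (hTS : T ⊆ S)
    (p q : ℤ) :
    openEuler (algRelint (polytope M) ∩ rankRegion S T p q) =
      (-1) ^ dim (polytope M) * if p < rk M S ∧ q < rk M T then 1 else 0 := by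
  by_cases h : (algRelint (polytope M) ∩ rankRegion S T p q).Nonempty
  · rw [if_pos ((algRelint_inter_rankRegion_nonempty_iff M hTS p q).1 h), mul_one,
      openEuler_of_nonempty h, dim, vectorSpan_algRelint_inter (convex_polytope M) _ h, dim]
    exact fun x hx v => exists_prolong_mem_interior
      ((isOpen_rankRegion S T p q).interior_eq.symm ▸ hx) v
  · rw [if_neg fun h' => h ((algRelint_inter_rankRegion_nonempty_iff M hTS p q).2 h'), mul_zero,
      openEuler_of_not_nonempty h]

end MatroidPolytopes

/-! ### Decomposition into relative interiors of cells -/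

section Subdivisions

variable {n : ℕ} {M : Mat n} {D : Set (Set (Fin n → ℝ))}

namespace IsMatroidalSubdivision

lemma subset_polytope (hD : IsMatroidalSubdivision M D) {F : Set (Fin n → ℝ)} (hF : F ∈ D) :
    F ⊆ polytope M := hD.sUnion_eq ▸ Set.subset_sUnion_of_mem hF

/-- A cell of least dimension containing `x` works: otherwise `x` would lie in a proper exposed
face, a cell of smaller dimension. -/
lemma exists_mem_algRelint (hD : IsMatroidalSubdivision M D) {x : Fin n → ℝ}
    (hx : x ∈ polytope M) : ∃ F ∈ D, x ∈ algRelint F := by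
  classical
  have hex : ∃ d : ℕ, ∃ F ∈ D, x ∈ F ∧ dim F = d := by
    rw [← hD.sUnion_eq] at hx
    obtain ⟨F, hF, hxF⟩ := hx
    exact ⟨_, F, hF, hxF, rfl⟩
  obtain ⟨F, hF, hxF, hd⟩ := Nat.find_spec hex
  refine ⟨F, hF, ?_⟩
  by_contra hxr
  have hFc : Convex ℝ F := by
    obtain ⟨N, rfl⟩ := hD.matroidal F hF
    exact convex_polytope N
  obtain ⟨f, hf, y, hy, hyx⟩ := exists_support_of_notMem_algRelint hFc hxF hxr
  have hxG : x ∈ f.toExposed F := ⟨hxF, hf⟩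
  have hGD := hD.face_mem F hF _ ContinuousLinearMap.toExposed.isExposed ⟨x, hxG⟩
  refine Nat.find_min hex (m := dim (f.toExposed F)) ?_ ⟨_, hGD, hxG, rfl⟩
  rw [← hd]
  refine Submodule.finrank_lt_finrank_of_lt (lt_of_le_of_ne
    (vectorSpan_mono ℝ fun z hz => hz.1) fun heq => hyx.ne ?_)
  have hker : vectorSpan ℝ (f.toExposed F) ≤ LinearMap.ker f.toLinearMap := by
    rw [vectorSpan_eq_span_vsub_set_right ℝ hxG, Submodule.span_le]
    rintro _ ⟨z, hz, rfl⟩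
    have : f z = f x := le_antisymm (hf z hz.1) (hz.2 x hxF)
    simp [this]
  have := hker (heq ▸ vsub_mem_vectorSpan ℝ hy hxF)
  simpa [sub_eq_zero] using this

/-- An exposed face that meets the relative interior of a cell is the whole cell; apply this to the
common face in both cells. -/
lemma eq_of_mem_algRelint (hD : IsMatroidalSubdivision M D) {F G : Set (Fin n → ℝ)}
    (hF : F ∈ D) (hG : G ∈ D) {x : Fin n → ℝ} (hxF : x ∈ algRelint F) (hxG : x ∈ algRelint G) :
    F = G := by
  have key : ∀ {A B : Set (Fin n → ℝ)}, IsExposed ℝ A (A ∩ B) → x ∈ algRelint A →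
      x ∈ B → A ⊆ B := by
    intro A B hAB hxA hxB
    obtain ⟨l, hl⟩ := hAB ⟨x, hxA.1, hxB⟩
    have hx : x ∈ A ∩ B := ⟨hxA.1, hxB⟩
    rw [hl] at hx
    intro y hy
    have hconst := fun {z} (hz : z ∈ A) => eq_of_isMax_algRelint hxA l.toLinearMap hx.2 hz
    have : y ∈ A ∩ B := by
      rw [hl]
      exact ⟨hy, fun z hz => ((hconst hz).trans (hconst hy).symm).le⟩
    exact this.2
  obtain ⟨h1, h2⟩ := hD.inter_face F hF G hG
  exact (key h1 hxF hxG.1).antisymm (key (Set.inter_comm F G ▸ h2) hxG hxF.1)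

lemma mem_internalFaces_iff (hD : IsMatroidalSubdivision M D) {F : Set (Fin n → ℝ)} (hF : F ∈ D) :
    F ∈ internalFaces M D ↔ ∃ z ∈ F, z ∈ algRelint (polytope M) := by
  rw [internalFaces, Set.mem_ofPred_eq,
    intrinsicFrontier_eq_sdiff_algRelint (convex_polytope M) (isClosed_polytope M)]
  refine ⟨fun ⟨_, h⟩ => ?_, fun ⟨z, hz, hzr⟩ => ⟨hF, fun h => (h hz).2 hzr⟩⟩
  obtain ⟨z, hz, hzn⟩ := Set.not_subset.1 h
  refine ⟨z, hz, ?_⟩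
  by_contra hzr
  exact hzn ⟨hD.subset_polytope hF hz, hzr⟩

/-- Some `z ∈ F` is relatively interior to `P(M)`, and prolonging from `z` beyond `x` inside `F`
puts `x` on a segment starting at `z`, short of its far end. -/
lemma algRelint_subset_of_mem_internalFaces (hD : IsMatroidalSubdivision M D)
    {F : Set (Fin n → ℝ)} (hF : F ∈ internalFaces M D) :
    algRelint F ⊆ algRelint (polytope M) := by
  intro x hx
  obtain ⟨z, hz, hzr⟩ := (hD.mem_internalFaces_iff hF.1).1 hF
  obtain ⟨ε, hε, hm⟩ := hx.2 z hz
  have h1 : 1 + ε ≠ 0 := by positivity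
  have := combo_mem_algRelint (convex_polytope M) hzr (hD.subset_polytope hF.1 hm)
    (t := 1 / (1 + ε)) (by positivity) ((div_lt_one (by positivity)).2 (by linarith))
  convert this using 1
  match_scalars <;> field_simp
  ring

open scoped Classical in
/-- The relative interior of `P(M)` is the disjoint union of the relative interiors of the internal
faces of a subdivision. -/
lemma sum_indicator_algRelint (hD : IsMatroidalSubdivision M D) (x : Fin n → ℝ) :
    ∑ N : Mat n with polytope N ∈ internalFaces M D,
      (algRelint (polytope N)).indicator (1 : (Fin n → ℝ) → ℤ) x =
        (algRelint (polytope M)).indicator 1 x := by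
  by_cases hx : x ∈ algRelint (polytope M)
  · obtain ⟨F, hF, hxF⟩ := hD.exists_mem_algRelint hx.1
    obtain ⟨N, rfl⟩ := hD.matroidal F hF
    rw [Finset.sum_eq_single N]
    · simp [hx, hxF]
    · intro N' hN' hne
      refine Set.indicator_of_notMem (fun hxN' => hne (polytope_injective ?_)) _
      exact hD.eq_of_mem_algRelint (Finset.mem_filter.1 hN').2.1 hF hxN' hxF
    · intro h
      refine absurd ?_ h
      rw [Finset.mem_filter]
      exact ⟨Finset.mem_univ _, (hD.mem_internalFaces_iff hF).2 ⟨x, hxF.1, hx⟩⟩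
  · rw [Set.indicator_of_notMem hx]
    exact Finset.sum_eq_zero fun N hN => Set.indicator_of_notMem (fun h =>
      hx (hD.algRelint_subset_of_mem_internalFaces (Finset.mem_filter.1 hN).2 h)) _

open scoped Classical in
lemma sum_openEuler_inter (hD : IsMatroidalSubdivision M D) {K : Set (Fin n → ℝ)}
    (hK : RelOpenConvex K) :
    ∑ N : Mat n with polytope N ∈ internalFaces M D, openEuler (algRelint (polytope N) ∩ K) =
      openEuler (algRelint (polytope M) ∩ K) := by
  -- The index `none` stands for `P(M)` itself, with coefficient `-1`.
  have h := sum_openEuler_eq_zero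
    (Finset.insertNone (Finset.univ.filter fun N : Mat n => polytope N ∈ internalFaces M D))
    (fun o => o.elim (-1) fun _ => 1)
    (fun o => algRelint (polytope (o.elim M id)) ∩ K)
    (fun o _ => (relOpenConvex_algRelint (convex_polytope _)).inter hK)
    (fun o _ => (bddBelow_polytope _).mono
      (Set.inter_subset_left.trans (algRelint_subset _))) (fun x => ?_)
  · rw [Finset.sum_insertNone] at h
    simp only [Option.elim, id, one_mul] at h
    linarith
  · rw [Finset.sum_insertNone]
    simp only [Option.elim, id, one_mul]
    by_cases hx : x ∈ K
    · have := hD.sum_indicator_algRelint x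
      have hi : ∀ A : Set (Fin n → ℝ), (A ∩ K).indicator (1 : (Fin n → ℝ) → ℤ) x =
          A.indicator 1 x := fun A => by by_cases hA : x ∈ A <;> simp [hA, hx]
      simp only [hi]
      linarith
    · simp [hx]

end IsMatroidalSubdivision

end Subdivisions

/-! ### From indicators to the expected codimension -/

section Valuative

variable {n : ℕ}

open scoped Classical in
/-- The indicator function of a lower bound on the ranks of a two-element chain is valuative. -/
lemma isValuative_indicator_lt_rk {S T : Finset (Fin n)} (hTS : T ⊆ S) (p q : ℤ) :
    IsValuative fun M : Mat n => if p < rk M S ∧ q < rk M T then (1 : ℤ) else 0 := by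
  intro M D hD
  have h := hD.sum_openEuler_inter (relOpenConvex_rankRegion S T p q)
  simp only [openEuler_algRelint_inter_rankRegion _ hTS] at h
  have hsq : ((-1 : ℤ) ^ dim (polytope M)) * (-1) ^ dim (polytope M) = 1 := by
    rw [← mul_pow]; simp
  have h2 := congrArg (fun r => (-1 : ℤ) ^ dim (polytope M) * r) h
  simp only [← mul_assoc, hsq, one_mul, Finset.mul_sum] at h2
  simp only [Int.negOnePow_sub, Units.val_mul, Int.coe_negOnePow_natCast, smul_eq_mul]
  exact h2.symm

namespace IsValuative

lemma add {f g : Mat n → ℤ} (hf : IsValuative f) (hg : IsValuative g) :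
    IsValuative fun M => f M + g M := by
  intro M D hD
  simp only [smul_add, Finset.sum_add_distrib]
  exact congrArg₂ (· + ·) (hf M D hD) (hg M D hD)

lemma const_mul {f : Mat n → ℤ} (r : ℤ) (hf : IsValuative f) :
    IsValuative fun M => r * f M := by
  intro M D hD
  simp only [hf M D hD, Finset.mul_sum, smul_eq_mul]
  exact Finset.sum_congr rfl fun N _ => by ring

lemma sub {f g : Mat n → ℤ} (hf : IsValuative f) (hg : IsValuative g) :
    IsValuative fun M => f M - g M := by
  simpa [sub_eq_add_neg] using hf.add (hg.const_mul (-1))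

lemma sum {ι : Type*} (s : Finset ι) {f : ι → Mat n → ℤ} (h : ∀ i ∈ s, IsValuative (f i)) :
    IsValuative fun M => ∑ i ∈ s, f i M := by
  intro M D hD
  simp only [Finset.smul_sum]
  rw [Finset.sum_comm]
  exact Finset.sum_congr rfl fun i hi => h i hi M D hD

end IsValuative

lemma rk_nonneg (M : Mat n) (S : Finset (Fin n)) : 0 ≤ rk M S := Nat.cast_nonneg _

lemma rk_le_card (M : Mat n) (S : Finset (Fin n)) : rk M S ≤ S.card := by
  rw [rk, Nat.cast_le]
  refine ENat.toNat_le_of_le_natCast ((M.1.eRk_le_encard _).trans ?_)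
  rw [Set.encard_coe_eq_coe_finsetCard]

open scoped Classical in
lemma rk_eq_sum (M : Mat n) (S : Finset (Fin n)) :
    rk M S = ∑ p ∈ Finset.range S.card, if (p : ℤ) < rk M S then 1 else 0 := by
  obtain ⟨r, hr⟩ := Int.eq_ofNat_of_zero_le (rk_nonneg M S)
  have hle := rk_le_card M S
  rw [hr] at hle ⊢
  rw [Finset.sum_boole]
  have : (Finset.range S.card).filter (fun p : ℕ => (p : ℤ) < (r : ℤ)) = Finset.range r := by
    ext p
    simp only [Finset.mem_filter, Finset.mem_range]
    omega
  rw [this, Finset.card_range]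

lemma isValuative_rk (S : Finset (Fin n)) : IsValuative fun M : Mat n => rk M S := by
  classical
  have h : IsValuative fun M : Mat n => ∑ p ∈ Finset.range S.card,
      -- The bound `-1` makes the second condition vacuous.
      if ((p : ℤ) < rk M S ∧ -1 < rk M S) then (1 : ℤ) else 0 :=
    .sum _ fun p _ => isValuative_indicator_lt_rk subset_rfl _ _
  convert h using 2 with M
  conv_lhs => rw [rk_eq_sum]
  refine Finset.sum_congr rfl fun p _ => ?_
  have : -1 < rk M S := by linarith [rk_nonneg M S]
  simp [this]

lemma isValuative_rk_mul_rk {S T : Finset (Fin n)} (hTS : T ⊆ S) :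
    IsValuative fun M : Mat n => rk M S * rk M T := by
  classical
  have h : IsValuative fun M : Mat n => ∑ p ∈ Finset.range S.card, ∑ q ∈ Finset.range T.card,
      if ((p : ℤ) < rk M S ∧ (q : ℤ) < rk M T) then (1 : ℤ) else 0 :=
    .sum _ fun p _ => .sum _ fun q _ => isValuative_indicator_lt_rk hTS _ _
  convert h using 2 with M
  conv_lhs => rw [rk_eq_sum M S, rk_eq_sum M T, Finset.sum_mul_sum]
  refine Finset.sum_congr rfl fun p _ => Finset.sum_congr rfl fun q _ => ?_
  rw [ite_and, mul_ite, mul_one, mul_zero]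
  split_ifs <;> rfl

lemma a_eq (M : Mat n) (𝔖 : Finset (Finset (Fin n))) (S : Finset (Fin n)) :
    a M 𝔖 S = c M S - ∑ T ∈ 𝔖 with T ⊂ S, a M 𝔖 T := by
  rw [a, Finset.sum_attach _ (fun T => a M 𝔖 T)]

/-- The factor `rk S` ranges over all `S ⊇ T` so that the induction survives the recursion for `a`:
subsets of `T` are still contained in `S`. -/
lemma isValuative_rk_mul_a (𝔖 : Finset (Finset (Fin n))) (T : Finset (Fin n)) :
    ∀ S, T ⊆ S → IsValuative fun M : Mat n => rk M S * a M 𝔖 T := by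
  induction T using Finset.strongInduction with
  | H T ih =>
    intro S hTS
    have h1 : IsValuative fun M : Mat n => (T.card : ℤ) * rk M S - rk M S * rk M T -
        ∑ T' ∈ 𝔖 with T' ⊂ T, rk M S * a M 𝔖 T' :=
      (((isValuative_rk S).const_mul _).sub (isValuative_rk_mul_rk hTS)).sub
        (.sum _ fun T' hT' => ih T' (Finset.mem_filter.1 hT').2 S
          ((Finset.mem_filter.1 hT').2.1.trans hTS))
    convert h1 using 2 with M
    rw [a_eq, c, ← Finset.mul_sum]
    ring

lemma isValuative_ecWith (𝔖 : Finset (Finset (Fin n))) :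
    IsValuative fun M : Mat n => ecWith 𝔖 M := by
  refine IsValuative.sum _ fun S _ => ?_
  simp only [sub_mul]
  exact (isValuative_rk_mul_a 𝔖 S _ (Finset.subset_univ S)).sub
    (isValuative_rk_mul_a 𝔖 S S subset_rfl)

end Valuative

/-! ### Invariance under relabelling -/

section Invariance

variable {n : ℕ} {M N : Mat n} {σ : Equiv.Perm (Fin n)}

/-- The rank of `S` is the maximum of `#(B ∩ S)` over bases `B`, which `σ` preserves. -/
lemma rk_map (h : ∀ B : Set (Fin n), M.1.IsBase B ↔ N.1.IsBase (σ '' B)) (S : Finset (Fin n)) :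
    rk N (S.map σ.toEmbedding) = rk M S := by
  have hcard : ∀ B : Set (Fin n),
      (σ '' B ∩ (S.map σ.toEmbedding : Finset (Fin n))).ncard = (B ∩ S).ncard := by
    intro B
    rw [Finset.coe_map, Equiv.coe_toEmbedding, ← Set.image_inter σ.injective,
      Set.ncard_image_of_injective _ σ.injective]
  apply le_antisymm
  · obtain ⟨B, hB, hS, -⟩ := exists_isBase_ncard_inter_eq_rk N
      (subset_rfl : S.map σ.toEmbedding ⊆ S.map σ.toEmbedding)
    obtain ⟨B, rfl⟩ := σ.surjective.image_surjective B
    rw [hS, hcard]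
    exact ncard_inter_le_rk M ((h B).2 hB) S
  · obtain ⟨B, hB, hS, -⟩ := exists_isBase_ncard_inter_eq_rk M (subset_rfl : S ⊆ S)
    rw [hS, ← hcard]
    exact ncard_inter_le_rk N ((h B).1 hB) _

lemma a_map (h : ∀ B : Set (Fin n), M.1.IsBase B ↔ N.1.IsBase (σ '' B)) (S : Finset (Fin n)) :
    a N Finset.univ (S.map σ.toEmbedding) = a M Finset.univ S := by
  induction S using Finset.strongInduction with
  | H S ih =>
    rw [a_eq, a_eq, c, c, rk_map h, Finset.card_map]
    congr 1
    refine (Finset.sum_equiv σ.finsetCongr (fun T => ?_) fun T hT => ?_).symm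
    · simp [Equiv.finsetCongr_apply, Finset.map_ssubset_map]
    · exact (ih T (Finset.mem_filter.1 hT).2).symm

lemma isInvariant_ec : IsInvariant fun M : Mat n => ec M := by
  intro M N σ h
  change ec M = ec N
  rw [ec, ec, ecWith, ecWith]
  refine Finset.sum_equiv σ.finsetCongr (fun S => ?_) fun S _ => ?_
  · simp only [Finset.mem_univ]
  · rw [Equiv.finsetCongr_apply, a_map h, rk_map h, ← rk_map h Finset.univ, Finset.map_univ_equiv]

end Invariance

end ExpCodim

theorem mainTheorem3 (n : ℕ) :
    ExpCodim.IsInvariant (fun M : ExpCodim.Mat n => ExpCodim.ec M) ∧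
      ExpCodim.IsValuative (fun M : ExpCodim.Mat n => ExpCodim.ec M) :=
  ⟨ExpCodim.isInvariant_ec, ExpCodim.isValuative_ecWith Finset.univ⟩
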